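/- All languages are first-order languages with equality. Let $M$ be a structure in a countable language $L$, and let $\mathrm{acl}_M(\emptyset)$ be the union of the finite subsets of $M$ definable without parameters. For a non-empty finite set $B=\{b_0,\dots,b_{n-1}\}\subseteq M$ (distinct $b_i$) and an ordinal $\alpha$, define $\mathrm{sprk}(B,M)\ge\alpha$ by induction on $\alpha$: $\mathrm{sprk}(B,M)\ge 0$ iff $B\cap\mathrm{acl}_M(\emptyset)=\emptyset$; $\mathrm{sprk}(B,M)\ge\alpha+1$ iff for every $j<n$ and every quantifier-free $L$-formula $\varphi(w_0,\dots,w_{n-1})$ there is $b_j^*\in M\setminus B$ such that $M\models\varphi(b_0,\dots,b_j,\dots,b_{n-1})\leftrightarrow\varphi(b_0,\dots,b_j^*,\dots,b_{n-1})$ and $\mathrm{sprk}(B\cup\{b_j^*\},M)\ge\alpha$; for a limit ordinal $\alpha>0$, $\mathrm{sprk}(B,M)\ge\alpha$ iff $\mathrm{sprk}(B,M)\ge\beta$ for all $\beta<\alpha$. Let $\mathrm{sprk}(M)=\sup\{\mathrm{sprk}(B,M)+1\}$, over the non-empty finite $B\subseteq M$ with $\mathrm{sprk}(B,M)\ge 0$,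 if this supremum exists, and $\mathrm{sprk}(M)=\infty$ otherwise. Let $\lambda_{\omega_1}(\aleph_0)$ be the least cardinal $\lambda$ such that every structure $M$ of size $\lambda$ in any countable language has $\mathrm{sprk}(M)\ge\omega_1$. A structure $N$ is Borel if there are a standard Borel space $Z$, a Borel set $D\subseteq Z$ and an equivalence relation $E$ on $D$, Borel as a subset of $Z^2$, such that the universe of $N$ is $D/E$ and, for every $k$, the preimage in $Z^k$ of every subset of $N^k$ defined by an atomic formula is Borel. A family $\{c_\eta:\eta\in 2^\omega\}$ of pairwise distinct elements of an $L$-structure $N$ is asymptotically similar if for every $k$ and every first-order $L$-formula $\theta$ in $k$ variables there is $N_\theta\in\omega$ such that for all $\ell\ge N_\theta$, $N\models\theta(c_{\eta_0},\dots,c_{\eta_{k-1}})\leftrightarrow\theta(c_{\tau_0},\dots,c_{\tau_{k-1}})$ whenever $\eta_0|_\ell,\dots,\eta_{k-1}|_\ell$ are distinct and $\eta_i|_\ell=\tau_i|_\ell$ for all $i<k$. **Theorem (Shelah).** Let $L$ be a countable language and $\Phi$ a sentence of $L_{\omega_1,\omega}$. If $\Phi$ has a model of size at least $\lambda_{\omega_1}(\aleph_0)$,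 then $\Phi$ has a Borel model of size continuum that contains an asymptotically similar subset $\{c_\eta:\eta\in 2^\omega\}$. -/

import Mathlib

open scoped Cardinal Ordinal

universe u v w

namespace HanfContinuum

/-! ### The infinitary logic `L_{ω₁,ω}` -/

/-- `L_{ω₁,ω}`-formulas whose free variables are among `x₀, …, xₙ₋₁`: first-order formulas
closed in addition under countable conjunctions. Only finitely many variables are free in any
formula, and quantification is over a single variable at a time. Negation, countable disjunction
and the existential quantifier are obtained from `falsum`, `imp`, `all` and `conj`. -/
inductive InfFormula (L : FirstOrder.Language.{u, v}) : ℕ → Type (max u v)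
  | falsum {n : ℕ} : InfFormula L n
  | equal {n : ℕ} (t₁ t₂ : L.Term (Fin n)) : InfFormula L n
  | rel {n l : ℕ} (R : L.Relations l) (ts : Fin l → L.Term (Fin n)) : InfFormula L n
  | imp {n : ℕ} (φ ψ : InfFormula L n) : InfFormula L n
  | all {n : ℕ} (φ : InfFormula L (n + 1)) : InfFormula L n
  | conj {n : ℕ} (φ : ℕ → InfFormula L n) : InfFormula L n

/-- Satisfaction of an `L_{ω₁,ω}`-formula in a structure. -/
def InfFormula.Realize {L : FirstOrder.Language.{u, v}} {M : Type w} [L.Structure M] :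
    ∀ {n : ℕ}, InfFormula L n → (Fin n → M) → Prop
  | _, .falsum, _ => False
  | _, .equal t₁ t₂, x => t₁.realize x = t₂.realize x
  | _, .rel R ts, x => FirstOrder.Language.Structure.RelMap R (fun i => (ts i).realize x)
  | _, .imp φ ψ, x => φ.Realize x → ψ.Realize x
  | _, .all φ, x => ∀ a : M, φ.Realize (Fin.snoc x a)
  | _, .conj φ, x => ∀ i : ℕ, (φ i).Realize x

/-- `L_{ω₁,ω}`-sentences. -/
abbrev InfSentence (L : FirstOrder.Language.{u, v}) : Type (max u v) := InfFormula L 0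

/-- `M ⊨ Φ` for an `L_{ω₁,ω}`-sentence `Φ`. -/
def InfSentence.Models {L : FirstOrder.Language.{u, v}} (Φ : InfSentence L) (M : Type w) [L.Structure M] :
    Prop :=
  InfFormula.Realize (M := M) Φ Fin.elim0

/-! ### Splitting rank -/

section SplittingRank

variable (L : FirstOrder.Language.{u, v}) {M : Type w} [L.Structure M]

/-- The model-theoretic algebraic closure of `A` in `M`: all elements that lie in a finite subset
of `M` definable with parameters from `A`. -/
def acl (A : Set M) : Set M :=
  {a | ∃ s : Set M, A.Definable₁ L s ∧ s.Finite ∧ a ∈ s}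

open scoped Classical in
/-- `SplittingRankGE L α B` says `sprk(B, M) ≥ α`, by recursion on `α`. In the quantifier-free
formulas of the successor step the variables are indexed by the elements of `B` (one variable for
each element), and `c` is substituted for the element `j` of `B`. -/
noncomputable def SplittingRankGE (α : Ordinal.{w}) : Set M → Prop :=
  Ordinal.limitRecOn (motive := fun _ => Set M → Prop) α
    (fun B => B ∩ acl L (∅ : Set M) = ∅)
    (fun _ rankGE B =>
      ∀ (j : B) (φ : L.Formula B), FirstOrder.Language.BoundedFormula.IsQF φ →
        ∃ c : M, c ∉ B ∧
          (φ.Realize (fun b : B => (b : M)) ↔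
            φ.Realize (Function.update (fun b : B => (b : M)) j c)) ∧
          rankGE (insert c B))
    (fun α _ rankGE B => ∀ (β : Ordinal.{w}) (hβ : β < α), rankGE β hβ B)

theorem splittingRankGE_zero (B : Set M) :
    SplittingRankGE L 0 B ↔ B ∩ acl L (∅ : Set M) = ∅ := by
  simp only [SplittingRankGE, Ordinal.limitRecOn_zero]

open scoped Classical in
theorem splittingRankGE_add_one (α : Ordinal.{w}) (B : Set M) :
    SplittingRankGE L (α + 1) B ↔
      ∀ (j : B) (φ : L.Formula B), FirstOrder.Language.BoundedFormula.IsQF φ →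
        ∃ c : M, c ∉ B ∧
          (φ.Realize (fun b : B => (b : M)) ↔
            φ.Realize (Function.update (fun b : B => (b : M)) j c)) ∧
          SplittingRankGE L α (insert c B) := by
  simp only [SplittingRankGE, Ordinal.limitRecOn_add_one]

theorem splittingRankGE_limit {α : Ordinal.{w}} (hα : Order.IsSuccLimit α) (B : Set M) :
    SplittingRankGE L α B ↔ ∀ β < α, SplittingRankGE L β B := by
  simp only [SplittingRankGE, Ordinal.limitRecOn_limit _ _ _ _ hα]

/-- `sprk(B, M)`, the largest `α` with `sprk(B, M) ≥ α`, or `⊤` if this holds for all `α`. It is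
meaningful for non-empty finite `B` with `sprk(B, M) ≥ 0`. -/
noncomputable def splittingRank (B : Set M) : WithTop Ordinal.{w} :=
  sSup {x | ∃ α : Ordinal.{w}, SplittingRankGE L α B ∧ x = (α : WithTop Ordinal.{w})}

variable (M) in
/-- `sprk(M)`, the supremum of `sprk(B, M) + 1` over all non-empty finite `B ⊆ M` for which
`sprk(B, M)` is defined, that is `sprk(B, M) ≥ 0`; it is `⊤` if there is no supremum among the
ordinals. -/
noncomputable def structureSplittingRank : WithTop Ordinal.{w} :=
  sSup {x | ∃ B : Set M, B.Finite ∧ B.Nonempty ∧ SplittingRankGE L 0 B ∧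
    x = splittingRank L B + 1}

end SplittingRank

/-- Every structure of cardinality `κ`, in every countable language, has splitting rank at
least `ω₁`. -/
def ForcesSplitting (κ : Cardinal.{w}) : Prop :=
  ∀ (L : FirstOrder.Language.{0, 0}), Countable L.Symbols → ∀ (M : Type w) [L.Structure M], #M = κ →
    ((ω₁ : Ordinal.{w}) : WithTop Ordinal.{w}) ≤ structureSplittingRank L M

/-- `λ_{ω₁}(ℵ₀)`, the least cardinal `κ` such that every structure of cardinality `κ` in a
countable language has splitting rank at least `ω₁`. The infimum is taken in the cardinals
extended by a top element, so that the default value `0` of the infimum of an empty set of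
cardinals plays no role. -/
noncomputable def lambdaOmegaOne : WithTop Cardinal.{w} :=
  sInf {x | ∃ κ : Cardinal.{w}, ForcesSplitting κ ∧ x = (κ : WithTop Cardinal.{w})}

/-! ### Borel structures -/

/-- `N` is a Borel structure: it is presented as the quotient `D / E` of a Borel subset `D` of a
standard Borel space `Z` by a Borel equivalence relation `E` (the kernel of the surjection `π`), in
such a way that every subset of `N ^ k` defined by an atomic formula has Borel preimage. -/
def IsBorelStructure (L : FirstOrder.Language.{u, v}) (N : Type w) [L.Structure N] : Prop :=
  ∃ (Z : Type w) (_ : MeasurableSpace Z) (_ : StandardBorelSpace Z) (D : Set Z) (π : D → N),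
    MeasurableSet D ∧ Function.Surjective π ∧
    MeasurableSet {p : Z × Z | ∃ (h₁ : p.1 ∈ D) (h₂ : p.2 ∈ D), π ⟨p.1, h₁⟩ = π ⟨p.2, h₂⟩} ∧
    ∀ (k : ℕ) (φ : L.Formula (Fin k)), FirstOrder.Language.BoundedFormula.IsAtomic φ →
      MeasurableSet {z : Fin k → Z | ∃ h : ∀ i, z i ∈ D, φ.Realize (fun i => π ⟨z i, h i⟩)}

/-! ### Asymptotic similarity -/

/-- A tuple of elements of `2^ω` splits by `l`: the restrictions to `l` are distinct. -/
def SplitsBy (l : ℕ) {k : ℕ} (η : Fin k → ℕ → Bool) : Prop :=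
  Function.Injective fun (i : Fin k) (m : Fin l) => η i m

/-- Two tuples of elements of `2^ω` are similar (mod `l`). -/
def SimilarMod (l : ℕ) {k : ℕ} (η τ : Fin k → ℕ → Bool) : Prop :=
  SplitsBy l η ∧ ∀ (i : Fin k) (m : ℕ), m < l → η i m = τ i m

/-- The indexed set `{a_η : η ∈ 2^ω}`, with distinct elements for distinct indices, is
asymptotically similar. -/
def AsymptoticallySimilar (L : FirstOrder.Language.{u, v}) {N : Type w} [L.Structure N]
    (a : (ℕ → Bool) → N) : Prop :=
  Function.Injective a ∧
    ∀ (k : ℕ) (θ : L.Formula (Fin k)), ∃ n : ℕ, ∀ l ≥ n, ∀ η τ : Fin k → ℕ → Bool,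
      SimilarMod l η τ → (θ.Realize (fun i => a (η i)) ↔ θ.Realize (fun i => a (τ i)))

end HanfContinuum

/-! Expand `M` by relation symbols and Skolem functions for a countable fragment that contains `Φ`
and all first-order formulas. Satisfaction then amounts to universal first-order clauses
(`ObeysUniversal`) and one infinitary clause, that a conjunction holds where all its members do
(`ObeysConj`). Some `κ ≤ #M` forces splitting, and closing `κ` elements under the functions gives a
substructure of size `κ`, so of rank at least `ω₁` in the expanded language.

Call a predicate large if it has injective realizations of every countable rank. Rank allows all
coordinates of a large quantifier-free predicate to be doubled (`Large.split`). A countable supremum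
of countable ordinals is countable, so one member of a countable cover can be added
(`Large.exists_and`). Alternating the two gives a binary tree (`exists_tree`) that decides countably
many covers: each quantifier-free formula against its negation and, for each conjunction at each
tuple of terms, an `i` such that the conjunction fails only where member `i` fails.

The model is the substructure of an ultrapower generated by the branches. Quantifier-free truth in
it is eventual truth along the tree (`realize_value_iff`), which makes it Borel and the branches
asymptotically similar. The decided `i` restores the conjunction clause (`obeysConj_hull`), which
the ultrapower alone need not satisfy. -/

namespace HanfContinuum

open FirstOrder FirstOrder.Language Set

/-! ### Splitting rank and large predicates -/

section Rank

variable {L : FirstOrder.Language.{u, v}} {M : Type w} [L.Structure M]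

theorem SplittingRankGE.anti_right {α β : Ordinal.{w}} (h : β ≤ α) {B : Set M} (hB : B.Nonempty)
    (hα : SplittingRankGE L α B) : SplittingRankGE L β B := by
  induction α using Ordinal.limitRecOn generalizing β B with
  | zero => rwa [nonpos_iff_eq_zero.1 h]
  | limit α hl ih =>
    rcases h.eq_or_lt with rfl | h
    · exact hα
    · exact (splittingRankGE_limit L hl B).1 hα β h
  | add_one γ ih =>
    rcases h.eq_or_lt with rfl | h
    · exact hα
    replace h : β ≤ γ := Order.lt_add_one_iff.1 h
    rw [splittingRankGE_add_one] at hα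
    induction β using Ordinal.limitRecOn with
    | zero =>
      obtain ⟨j, hj⟩ := hB
      obtain ⟨c, -, -, hc⟩ := hα ⟨j, hj⟩ ⊤ BoundedFormula.IsQF.top
      have := ih h (insert_nonempty c B) hc
      rw [splittingRankGE_zero] at this ⊢
      rw [← disjoint_iff_inter_eq_empty] at this ⊢
      exact this.mono_left (subset_insert c B)
    | add_one δ _ =>
      rw [splittingRankGE_add_one]
      intro j φ hφ
      obtain ⟨c, hc, hr, hc'⟩ := hα j φ hφ
      exact ⟨c, hc, hr, ih ((Order.lt_add_one_iff.2 le_rfl).le.trans h) (insert_nonempty c B) hc'⟩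
    | limit δ hl ihδ =>
      rw [splittingRankGE_limit L hl]
      exact fun ε hε => ihδ ε hε ((hε.le.trans h).trans (Order.lt_add_one_iff.2 le_rfl).le)
        (hε.le.trans h)

/-- A formula in variables from `A` is also one in variables from `B`, so the witness that splits
`B` splits `A`. -/
theorem SplittingRankGE.anti_set {α : Ordinal.{w}} {A B : Set M} (h : A ⊆ B)
    (hB : SplittingRankGE L α B) : SplittingRankGE L α A := by
  induction α using Ordinal.limitRecOn generalizing A B with
  | zero =>
    rw [splittingRankGE_zero, ← disjoint_iff_inter_eq_empty] at hB ⊢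
    exact hB.mono_left h
  | limit α hl ih =>
    rw [splittingRankGE_limit L hl] at hB ⊢
    exact fun β hβ => ih β hβ h (hB β hβ)
  | add_one γ ih =>
    classical
    rw [splittingRankGE_add_one] at hB ⊢
    intro j φ hφ
    obtain ⟨c, hc, hr, hc'⟩ := hB ⟨j, h j.2⟩ (φ.relabel (inclusion h)) (hφ.relabel _)
    refine ⟨c, fun hA => hc (h hA), ?_, ih (insert_subset_insert h) hc'⟩
    rw [Formula.realize_relabel, Formula.realize_relabel] at hr
    have key : Function.update (fun b : A => (b : M)) j c =
        Function.update (fun b : B => (b : M)) ⟨j, h j.2⟩ c ∘ inclusion h := by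
      ext b
      by_cases hb : b = j
      · subst hb; simp [inclusion]
      · have : inclusion h b ≠ ⟨j, h j.2⟩ := fun e => hb (inclusion_injective h e)
        simp [hb, this]
    rw [key]
    exact hr

/-- Quantifier-free definable predicates on tuples. -/
def QFPred (L : FirstOrder.Language.{u, v}) {M : Type w} [L.Structure M] {ι : Type*}
    (P : (ι → M) → Prop) : Prop :=
  ∃ φ : L.Formula ι, BoundedFormula.IsQF φ ∧ ∀ x, φ.Realize x ↔ P x

theorem QFPred.true {ι : Type*} : QFPred L fun _ : ι → M => True :=
  ⟨⊤, BoundedFormula.IsQF.top, fun _ => by simp⟩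

theorem QFPred.and {ι : Type*} {P Q : (ι → M) → Prop} (hP : QFPred L P) (hQ : QFPred L Q) :
    QFPred L fun x => P x ∧ Q x := by
  obtain ⟨φ, hφ, h⟩ := hP
  obtain ⟨ψ, hψ, h'⟩ := hQ
  exact ⟨φ ⊓ ψ, hφ.inf hψ, fun x => by rw [Formula.realize_inf, h, h']⟩

theorem QFPred.comp {ι κ : Type*} {P : (ι → M) → Prop} (hP : QFPred L P) (f : ι → κ) :
    QFPred L fun y : κ → M => P fun i => y (f i) := by
  obtain ⟨φ, hφ, h⟩ := hP
  exact ⟨φ.relabel f, hφ.relabel _, fun x => by rw [Formula.realize_relabel, h]; rfl⟩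

theorem QFPred.forall {ι κ : Type*} [Finite κ] {P : κ → (ι → M) → Prop}
    (hP : ∀ k, QFPred L (P k)) : QFPred L fun x => ∀ k, P k x := by
  classical
  have := Fintype.ofFinite κ
  suffices H : ∀ S : Finset κ, QFPred L fun x => ∀ k ∈ S, P k x by simpa using H Finset.univ
  intro S
  induction S using Finset.induction_on with
  | empty => simpa using QFPred.true
  | insert a S _ ih => simpa using (hP a).and ih

/-- Coordinates are doubled one at a time, each at the cost of one rank. What survives each step is
that `P` holds for every mixture of old and new coordinates: a finite conjunction of quantifier-free
conditions, hence again quantifier-free. -/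
theorem exists_split_on {ι : Type*} [DecidableEq ι] [Finite ι] {P : (ι → M) → Prop} (hP : QFPred L P)
    (S : Finset ι) {α : Ordinal.{w}} {x : ι → M} (hx : Function.Injective x) (hPx : P x)
    (hr : SplittingRankGE L (α + S.card) (range x)) :
    ∃ y : ι → M, (∀ i ∉ S, y i = x i) ∧ (∀ i ∈ S, ∀ j, y i ≠ x j) ∧ InjOn y S ∧
      SplittingRankGE L α (range x ∪ range y) ∧
      ∀ σ : ι → Bool, P fun i => if σ i then y i else x i := by
  induction S using Finset.induction_on generalizing α with
  | empty => exact ⟨x, by simp, by simp, by simp, by simpa using hr, by simpa using hPx⟩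
  | insert a S ha ih =>
    obtain ⟨y, h1, h2, h3, h4, h5⟩ := ih (α := α + 1) (by
      rw [Finset.card_insert_of_notMem ha] at hr
      convert hr using 1
      rw [add_assoc, add_comm S.card 1]; push_cast; rfl)
    have hmem : ∀ (σ : ι → Bool) i, (if σ i then y i else x i) ∈ range x ∪ range y := by
      intro σ i; split_ifs <;> simp
    obtain ⟨φ, hφ, hφr⟩ : QFPred L fun z : ↥(range x ∪ range y) → M =>
        ∀ σ : ι → Bool, P fun i => z ⟨_, hmem σ i⟩ :=
      QFPred.forall fun σ => hP.comp fun i => (⟨_, hmem σ i⟩ : ↥(range x ∪ range y))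
    rw [splittingRankGE_add_one] at h4
    obtain ⟨c, hc, hiff, hrk⟩ := h4 ⟨x a, by simp⟩ φ hφ
    rw [hφr, hφr] at hiff
    have h5' := hiff.1 h5
    simp only [mem_union, mem_range, not_or, not_exists] at hc
    refine ⟨Function.update y a c, ?_, ?_, ?_, hrk.anti_set ?_, ?_⟩
    · intro i hi
      simp only [Finset.mem_insert, not_or] at hi
      simp [hi.1, h1 i hi.2]
    · intro i hi j
      by_cases hia : i = a
      · subst hia; simpa using fun e => hc.1 j e.symm
      · simpa [hia] using h2 i ((Finset.mem_insert.1 hi).resolve_left hia) j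
    · intro i hi j hj hij
      by_cases hia : i = a <;> by_cases hja : j = a
      · rw [hia, hja]
      · subst hia; simp [hja] at hij; exact absurd hij.symm (hc.2 j)
      · subst hja; simp [hia] at hij; exact absurd hij (hc.2 i)
      · simp only [ne_eq, hia, not_false_eq_true, Function.update_of_ne, hja] at hij
        refine h3 ?_ ?_ hij
        · simpa [hia] using hi
        · simpa [hja] using hj
    · rintro z (⟨i, rfl⟩ | ⟨i, rfl⟩)
      · simp
      · by_cases hia : i = a
        · subst hia; simp
        · simp [hia]
    · intro σ
      have := h5' (Function.update σ a false)
      by_cases hσ : σ a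
      · convert this using 2 with i
        by_cases hia : i = a
        · subst hia; simp [hσ]
        -- Substituting `c` for the element `x a` affects coordinate `a` alone, as no other
        -- coordinate takes that value.
        · have : (if σ i then y i else x i) ≠ x a := by
            split_ifs
            · by_cases hi : i ∈ S
              · exact h2 i hi a
              · rw [h1 i hi]; exact hx.ne hia
            · exact hx.ne hia
          simp [hia, this]
      · convert h5 σ using 2 with i
        by_cases hia : i = a
        · subst hia; simp [hσ]
        · simp [hia]

/-- A predicate on finite tuples is large if it has injective realizations of every countable
splitting rank. -/
def Large (L : FirstOrder.Language.{u, v}) {M : Type w} [L.Structure M] {ι : Type*}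
    (P : (ι → M) → Prop) : Prop :=
  ∀ α < (ω₁ : Ordinal.{w}), ∃ x : ι → M, Function.Injective x ∧ P x ∧ SplittingRankGE L α (range x)

/-- If every `k` failed at some countable rank `α k`, then all would fail at the supremum of the `α
k`, which is still countable. -/
theorem Large.exists_and {ι : Type*} {κ : Type} [Nonempty ι] [Countable κ] {P : (ι → M) → Prop}
    (hP : Large L P) (Q : κ → (ι → M) → Prop) (hQ : ∀ x, P x → ∃ k, Q k x) :
    ∃ k, Large L fun x => P x ∧ Q k x := by
  by_contra! H
  simp only [Large, not_forall] at H
  choose α hα hα' using H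
  obtain ⟨x, hx, hPx, hr⟩ := hP (⨆ k, α k) (Ordinal.iSup_lt_omega_one hα)
  obtain ⟨k, hk⟩ := hQ x hPx
  exact hα' k ⟨x, hx, ⟨hPx, hk⟩, hr.anti_right (Ordinal.le_iSup α k) (range_nonempty x)⟩

theorem Large.split {ι : Type*} [Finite ι] {P : (ι → M) → Prop}
    (hP : Large L P) (hqf : QFPred L P) :
    Large L fun y : ι × Bool → M => ∀ σ : ι → Bool, P fun i => y (i, σ i) := by
  classical
  have := Fintype.ofFinite ι
  intro α hα
  obtain ⟨x, hx, hPx, hr⟩ := hP (α + (Finset.univ : Finset ι).card) (by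
    exact Ordinal.isPrincipal_add_omega 1 hα ((Ordinal.natCast_lt_omega0 _).trans Ordinal.omega0_lt_omega_one))
  obtain ⟨y, -, h2, h3, h4, h5⟩ := exists_split_on hqf Finset.univ hx hPx hr
  refine ⟨fun p => if p.2 then y p.1 else x p.1, ?_, h5, h4.anti_set ?_⟩
  · rintro ⟨i, p⟩ ⟨j, q⟩ h
    cases p <;> cases q <;> simp at h ⊢
    · exact hx h
    · exact h2 _ (by simp) _ h.symm
    · exact h2 _ (by simp) _ h
    · exact h3 (by simp) (by simp) h
  · rintro _ ⟨⟨i, p⟩, rfl⟩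
    cases p <;> simp

theorem Large.comp_equiv {ι κ : Type*} {P : (ι → M) → Prop} (hP : Large L P) (e : κ ≃ ι) :
    Large L fun y : κ → M => P fun i => y (e.symm i) := by
  intro α hα
  obtain ⟨x, hx, hPx, hr⟩ := hP α hα
  exact ⟨x ∘ e, hx.comp e.injective, by simpa using hPx, by rwa [e.surjective.range_comp]⟩

/-! ### The binary tree of realizations -/

/-- Restriction of an element of `2^ω` to its first `l` values. -/
def cut (l : ℕ) (η : ℕ → Bool) : Fin l → Bool := fun m => η m

/-- A node of length `l + 1` is a node of length `l` followed by a bit. -/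
def nodeEquiv (l : ℕ) : (Fin (l + 1) → Bool) ≃ (Fin l → Bool) × Bool where
  toFun s := (fun m => s m.castSucc, s (Fin.last l))
  invFun p := Fin.snoc p.1 p.2
  left_inv s := by
    ext m
    refine Fin.lastCases ?_ (fun m => ?_) m <;> simp
  right_inv p := by ext <;> simp

theorem cut_succ (l : ℕ) (η : ℕ → Bool) :
    cut (l + 1) η = (nodeEquiv l).symm (cut l η, η l) := by
  rw [Equiv.eq_symm_apply]; rfl

theorem cut_injective_mono {ι : Type*} {η : ι → ℕ → Bool} {l l' : ℕ} (h : l ≤ l')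
    (hl : Function.Injective fun i => cut l (η i)) :
    Function.Injective fun i => cut l' (η i) := by
  intro i j hij
  apply hl
  ext m
  exact congrFun hij ⟨m, m.2.trans_le h⟩

/-- One stage of the construction: split all nodes, and decide finitely many covers. -/
theorem Large.step {T : Type} (s : ℕ → T) (k : T → ℕ)
    (Q : ∀ t, ℕ → L.Formula (Fin (k t))) (hQ : ∀ t i, BoundedFormula.IsQF (Q t i))
    (cover : ∀ t (x : Fin (k t) → M), ∃ i, (Q t i).Realize x) {l : ℕ}
    {P : ((Fin l → Bool) → M) → Prop} (hP : Large L P) (hqf : QFPred L P) :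
    ∃ P' : ((Fin (l + 1) → Bool) → M) → Prop, (Large L P' ∧ QFPred L P') ∧
      (∀ y, P' y → ∀ σ : (Fin l → Bool) → Bool, P fun i => y ((nodeEquiv l).symm (i, σ i))) ∧
      ∀ n < l + 1, ∀ e : Fin (k (s n)) → Fin (l + 1) → Bool, ∃ i, ∀ y, P' y →
        (Q (s n) i).Realize fun j => y (e j) := by
  let P₁ : ((Fin (l + 1) → Bool) → M) → Prop :=
    fun y => ∀ σ : (Fin l → Bool) → Bool, P fun i => y ((nodeEquiv l).symm (i, σ i))
  have h₁ : Large L P₁ := (hP.split hqf).comp_equiv (nodeEquiv l)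
  have hqf₁ : QFPred L P₁ := QFPred.forall fun σ => hqf.comp fun i => (nodeEquiv l).symm (i, σ i)
  let S := Σ n : Fin (l + 1), (Fin (k (s n)) → Fin (l + 1) → Bool)
  -- All decisions of this stage are made at once: `S` is finite, so there are only countably many
  -- functions `S → ℕ`.
  obtain ⟨f, hf⟩ := h₁.exists_and (κ := S → ℕ)
    (fun f y => ∀ p : S, (Q (s p.1) (f p)).Realize fun j => y (p.2 j)) (fun y _ => by
      choose f hf using fun p : S => cover (s p.1) fun j => y (p.2 j)
      exact ⟨f, hf⟩)
  refine ⟨_, ⟨hf, hqf₁.and (QFPred.forall fun p => ?_)⟩, fun y hy => hy.1, fun n hn e =>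
    ⟨f ⟨⟨n, hn⟩, e⟩, fun y hy => hy.2 ⟨⟨n, hn⟩, e⟩⟩⟩
  exact QFPred.comp (P := fun x => (Q (s p.1) (f p)).Realize x) ⟨_, hQ _ _, fun _ => Iff.rfl⟩ p.2

/-- Given realizations of all countable splitting ranks and countably many countable covers by
quantifier-free formulas, there is a tree of elements along which the covers are decided. -/
theorem exists_tree {T : Type} [Countable T] [Nonempty T] (k : T → ℕ)
    (Q : ∀ t, ℕ → L.Formula (Fin (k t))) (hQ : ∀ t i, BoundedFormula.IsQF (Q t i))
    (cover : ∀ t (x : Fin (k t) → M), ∃ i, (Q t i).Realize x)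
    (hM : ∀ α < (ω₁ : Ordinal.{w}), ∃ B : Set M, B.Nonempty ∧ SplittingRankGE L α B) :
    ∃ b : ∀ l, (Fin l → Bool) → M, (∀ l, Function.Injective (b l)) ∧
      ∀ t, ∃ n, ∀ l ≥ n, ∀ e : Fin (k t) → Fin l → Bool, Function.Injective e →
        ∃ i, ∀ l' ≥ l, ∀ η : Fin (k t) → ℕ → Bool, (∀ j, cut l (η j) = e j) →
          (Q t i).Realize fun j => b l' (cut l' (η j)) := by
  obtain ⟨s, hs⟩ := exists_surjective_nat T
  have h₀ : Large L fun _ : (Fin 0 → Bool) → M => True := by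
    intro α hα
    obtain ⟨B, ⟨b, hb⟩, hB⟩ := hM α hα
    exact ⟨fun _ => b, Function.injective_of_subsingleton _, trivial,
      hB.anti_set (by rintro _ ⟨_, rfl⟩; exact hb)⟩
  choose next hnext using fun l (P : {P : ((Fin l → Bool) → M) → Prop // Large L P ∧ QFPred L P}) =>
    Large.step s k Q hQ cover P.2.1 P.2.2
  let P : ∀ l, {P : ((Fin l → Bool) → M) → Prop // Large L P ∧ QFPred L P} := fun l =>
    Nat.rec ⟨fun _ => True, h₀, QFPred.true⟩ (fun l P => ⟨next l P, (hnext l P).1⟩) l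
  have hsec : ∀ l y, (P (l + 1)).1 y → ∀ σ : (Fin l → Bool) → Bool,
      (P l).1 fun i => y ((nodeEquiv l).symm (i, σ i)) := fun l => (hnext l (P l)).2.1
  have hdec : ∀ l, ∀ n < l, ∀ e : Fin (k (s n)) → Fin l → Bool, ∃ i, ∀ y, (P l).1 y →
      (Q (s n) i).Realize fun j => y (e j) := by
    rintro (_ | l)
    · simp
    · exact (hnext l (P l)).2.2
  -- Realizations at different levels are chosen independently; only the predicates `P l` cohere,
  -- and rank `0` suffices here.
  choose b hb hb' _ using fun l => (P l).2.1 0 (Ordinal.omega_pos 1)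
  refine ⟨b, hb, fun t => ?_⟩
  obtain ⟨n, rfl⟩ := hs t
  refine ⟨n + 1, fun l hl e he => ?_⟩
  obtain ⟨i, hi⟩ := hdec l n hl e
  refine ⟨i, fun l' hl' η hη => ?_⟩
  suffices H : ∀ y, (P l').1 y → (Q (s n) i).Realize fun j => y (cut l' (η j)) from H _ (hb' l')
  have hinj : Function.Injective fun j => cut l (η j) := by simpa [hη] using he
  induction l', hl' using Nat.le_induction with
  | base => intro y hy; simpa [hη] using hi y hy
  | succ l' hl' ih =>
    intro y hy
    have hinj' := cut_injective_mono hl' hinj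
    -- Go down one level along the section that follows the branches `η j`. It is well defined
    -- because their cuts at `l'` are distinct; the bit at other nodes is irrelevant.
    convert ih _ (hsec l' y hy (Function.extend (fun j => cut l' (η j)) (fun j => η j l')
      fun _ => false)) using 2 with j
    rw [cut_succ, hinj'.extend_apply]

end Rank

end HanfContinuum

namespace HanfContinuum

open FirstOrder FirstOrder.Language Set

/-! ### Countable fragments -/

section Fragment

variable {L : FirstOrder.Language.{u, v}}

/-- The set of subformulas of an infinitary formula. -/
def InfFormula.subformulas : ∀ {n : ℕ}, InfFormula L n → Set (Σ n, InfFormula L n)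
  | n, .falsum => {⟨n, .falsum⟩}
  | n, .equal t s => {⟨n, .equal t s⟩}
  | n, .rel R ts => {⟨n, .rel R ts⟩}
  | n, .imp φ ψ => insert ⟨n, .imp φ ψ⟩ (φ.subformulas ∪ ψ.subformulas)
  | n, .all φ => insert ⟨n, .all φ⟩ φ.subformulas
  | n, .conj φ => insert ⟨n, .conj φ⟩ (⋃ i, (φ i).subformulas)

theorem InfFormula.self_mem_subformulas {n : ℕ} (φ : InfFormula L n) : ⟨n, φ⟩ ∈ φ.subformulas := by
  cases φ <;> simp [subformulas]

theorem InfFormula.countable_subformulas {n : ℕ} (φ : InfFormula L n) : φ.subformulas.Countable := by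
  induction φ with
  | falsum | equal | rel => exact countable_singleton _
  | imp φ ψ h h' => exact (h.union h').insert _
  | all φ h => exact h.insert _
  | conj φ h => exact (countable_iUnion h).insert _

/-- A set of formulas closed under immediate subformulas. -/
structure IsFragment (F : Set (Σ n, InfFormula L n)) : Prop where
  imp_left : ∀ {n} {φ ψ : InfFormula L n}, ⟨n, .imp φ ψ⟩ ∈ F → ⟨n, φ⟩ ∈ F
  imp_right : ∀ {n} {φ ψ : InfFormula L n}, ⟨n, .imp φ ψ⟩ ∈ F → ⟨n, ψ⟩ ∈ F
  all : ∀ {n} {φ : InfFormula L (n + 1)}, ⟨n, .all φ⟩ ∈ F → ⟨n + 1, φ⟩ ∈ F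
  conj : ∀ {n} {φ : ℕ → InfFormula L n}, ⟨n, .conj φ⟩ ∈ F → ∀ i, ⟨n, φ i⟩ ∈ F

theorem InfFormula.isFragment_subformulas {n : ℕ} (φ : InfFormula L n) :
    IsFragment φ.subformulas := by
  induction φ with
  | falsum | equal | rel =>
    constructor
    · rintro n χ χ' e; cases e
    · rintro n χ χ' e; cases e
    · rintro n χ e; cases e
    · rintro n χ e; cases e
  | imp φ ψ h h' =>
    constructor
    · rintro n χ χ' (e | e | e)
      · cases e; exact .inr (.inl φ.self_mem_subformulas)
      · exact .inr (.inl (h.imp_left e))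
      · exact .inr (.inr (h'.imp_left e))
    · rintro n χ χ' (e | e | e)
      · cases e; exact .inr (.inr ψ.self_mem_subformulas)
      · exact .inr (.inl (h.imp_right e))
      · exact .inr (.inr (h'.imp_right e))
    · rintro n χ (e | e | e)
      · cases e
      · exact .inr (.inl (h.all e))
      · exact .inr (.inr (h'.all e))
    · rintro n χ (e | e | e) i
      · cases e
      · exact .inr (.inl (h.conj e i))
      · exact .inr (.inr (h'.conj e i))
  | all φ h =>
    constructor
    · rintro n χ χ' (e | e)
      · cases e
      · exact .inr (h.imp_left e)
    · rintro n χ χ' (e | e)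
      · cases e
      · exact .inr (h.imp_right e)
    · rintro n χ (e | e)
      · cases e; exact .inr φ.self_mem_subformulas
      · exact .inr (h.all e)
    · rintro n χ (e | e) i
      · cases e
      · exact .inr (h.conj e i)
  | conj φ h =>
    constructor
    · rintro n χ χ' (e | e)
      · cases e
      · obtain ⟨j, hj⟩ := mem_iUnion.1 e
        exact .inr (mem_iUnion.2 ⟨j, (h j).imp_left hj⟩)
    · rintro n χ χ' (e | e)
      · cases e
      · obtain ⟨j, hj⟩ := mem_iUnion.1 e
        exact .inr (mem_iUnion.2 ⟨j, (h j).imp_right hj⟩)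
    · rintro n χ (e | e)
      · cases e
      · obtain ⟨j, hj⟩ := mem_iUnion.1 e
        exact .inr (mem_iUnion.2 ⟨j, (h j).all hj⟩)
    · rintro n χ (e | e) i
      · cases e; exact .inr (mem_iUnion.2 ⟨i, (φ i).self_mem_subformulas⟩)
      · obtain ⟨j, hj⟩ := mem_iUnion.1 e
        exact .inr (mem_iUnion.2 ⟨j, (h j).conj hj i⟩)

/-- The infinitary formula corresponding to a first-order formula. -/
def toInf {k : ℕ} : ∀ {n : ℕ}, L.BoundedFormula (Fin k) n → InfFormula L (k + n)
  | _, .falsum => .falsum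
  | _, .equal t s => .equal (t.relabel finSumFinEquiv) (s.relabel finSumFinEquiv)
  | _, .rel R ts => .rel R fun i => (ts i).relabel finSumFinEquiv
  | _, .imp φ ψ => .imp (toInf φ) (toInf ψ)
  | _, .all φ => .all (toInf (k := k) φ)

theorem realize_toInf {M : Type w} [L.Structure M] {k n : ℕ} (φ : L.BoundedFormula (Fin k) n)
    (x : Fin k → M) (y : Fin n → M) :
    (toInf φ).Realize (Fin.append x y) ↔ φ.Realize x y := by
  have key : ∀ {n} (y : Fin n → M), Fin.append x y ∘ finSumFinEquiv = Sum.elim x y := by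
    intro n y
    ext (i | i) <;> simp
  induction φ with
  | falsum => rfl
  | equal t s => simp [toInf, InfFormula.Realize, BoundedFormula.Realize, key]
  | rel R ts => simp [toInf, InfFormula.Realize, BoundedFormula.Realize, key]
  | imp φ ψ h h' => simp [toInf, InfFormula.Realize, h, h']
  | all φ h =>
    simp only [toInf, InfFormula.Realize, BoundedFormula.realize_all, ← h, Fin.append_snoc]

/-- First-order formulas are included so that each becomes a single relation symbol, which reduces
asymptotic similarity to atomic formulas of the expanded language. -/
theorem exists_fragment [Countable L.Symbols] {m : ℕ} (Φ : InfFormula L m) :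
    ∃ F : Set (Σ n, InfFormula L n), F.Countable ∧ IsFragment F ∧ ⟨m, Φ⟩ ∈ F ∧
      ∀ (k : ℕ) (θ : L.Formula (Fin k)), ⟨k, toInf θ⟩ ∈ F := by
  refine ⟨Φ.subformulas ∪ ⋃ (k : ℕ) (θ : L.Formula (Fin k)), (toInf θ).subformulas, ?_, ?_, ?_, ?_⟩
  · exact Φ.countable_subformulas.union
      (countable_iUnion fun k => countable_iUnion fun θ => (toInf θ).countable_subformulas)
  · constructor
    · rintro n φ ψ (h | h)
      · exact .inl (Φ.isFragment_subformulas.imp_left h)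
      · obtain ⟨k, θ, h⟩ := mem_iUnion₂.1 h
        exact .inr (mem_iUnion₂.2 ⟨k, θ, (toInf θ).isFragment_subformulas.imp_left h⟩)
    · rintro n φ ψ (h | h)
      · exact .inl (Φ.isFragment_subformulas.imp_right h)
      · obtain ⟨k, θ, h⟩ := mem_iUnion₂.1 h
        exact .inr (mem_iUnion₂.2 ⟨k, θ, (toInf θ).isFragment_subformulas.imp_right h⟩)
    · rintro n φ (h | h)
      · exact .inl (Φ.isFragment_subformulas.all h)
      · obtain ⟨k, θ, h⟩ := mem_iUnion₂.1 h
        exact .inr (mem_iUnion₂.2 ⟨k, θ, (toInf θ).isFragment_subformulas.all h⟩)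
    · rintro n φ (h | h) i
      · exact .inl (Φ.isFragment_subformulas.conj h i)
      · obtain ⟨k, θ, h⟩ := mem_iUnion₂.1 h
        exact .inr (mem_iUnion₂.2 ⟨k, θ, (toInf θ).isFragment_subformulas.conj h i⟩)
  · exact .inl Φ.self_mem_subformulas
  · exact fun k θ => .inr (mem_iUnion₂.2 ⟨k, θ, (toInf θ).self_mem_subformulas⟩)

end Fragment

/-! ### Satisfaction relations and Skolem functions -/

section Skolem

variable {L : FirstOrder.Language.{0, 0}} (F : Set (Σ n, InfFormula L n))

/-- A relation symbol for each formula of the fragment, and a Skolem function symbol for each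
formula of the fragment, naming a counterexample in the last variable. -/
def fragmentLanguage : FirstOrder.Language.{0, 0} where
  Functions n := {φ : InfFormula L (n + 1) // ⟨n + 1, φ⟩ ∈ F}
  Relations n := {φ : InfFormula L n // ⟨n, φ⟩ ∈ F}

/-- The expansion of `L` by relation symbols and Skolem functions for a fragment. -/
abbrev expandedLanguage : FirstOrder.Language.{0, 0} := L.sum (fragmentLanguage F)

theorem countable_expandedLanguage [Countable L.Symbols] (hF : F.Countable) :
    Countable (expandedLanguage F).Symbols := by
  have := hF.to_subtype
  have h : Countable (fragmentLanguage F).Symbols := by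
    have h₁ : Countable (Σ n, (fragmentLanguage F).Functions n) :=
      Function.Injective.countable (β := F) (f := fun p => ⟨⟨p.1 + 1, p.2.1⟩, p.2.2⟩) (by
        rintro ⟨n, φ, hφ⟩ ⟨m, ψ, hψ⟩ h
        simp only [Subtype.mk.injEq, Sigma.mk.injEq, Nat.add_right_cancel_iff] at h
        obtain ⟨rfl, h⟩ := h
        cases h; rfl)
    have h₂ : Countable (Σ n, (fragmentLanguage F).Relations n) :=
      Function.Injective.countable (β := F) (f := fun p => ⟨⟨p.1, p.2.1⟩, p.2.2⟩) (by
        rintro ⟨n, φ, hφ⟩ ⟨m, ψ, hψ⟩ h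
        simp only [Subtype.mk.injEq, Sigma.mk.injEq] at h
        obtain ⟨rfl, h⟩ := h
        cases h; rfl)
    exact inferInstanceAs (Countable (_ ⊕ _))
  rw [← Cardinal.mk_le_aleph0_iff]
  have h₁ : L.card ≤ ℵ₀ := Cardinal.mk_le_aleph0_iff.2 ‹_›
  have h₂ : (fragmentLanguage F).card ≤ ℵ₀ := Cardinal.mk_le_aleph0_iff.2 ‹_›
  change (L.sum (fragmentLanguage F)).card ≤ ℵ₀
  rw [card_sum]
  simpa using ⟨h₁, h₂⟩

variable {F}

/-- The Skolem function symbol of a formula. -/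
abbrev skolemSymbol {n : ℕ} {φ : InfFormula L (n + 1)} (h : ⟨n + 1, φ⟩ ∈ F) :
    (expandedLanguage F).Functions n :=
  LHom.sumInr.onFunction (⟨φ, h⟩ : (fragmentLanguage F).Functions n)

/-- The relation symbol of a formula. -/
abbrev formulaSymbol {n : ℕ} {φ : InfFormula L n} (h : ⟨n, φ⟩ ∈ F) :
    (expandedLanguage F).Relations n :=
  LHom.sumInr.onRelation (⟨φ, h⟩ : (fragmentLanguage F).Relations n)

variable (F)

/-- The relation symbols of the fragment obey all of the clauses in the definition of satisfaction,
except for the one that would infer a conjunction from its members. -/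
structure ObeysUniversal (A : Type w) [(expandedLanguage F).Structure A] : Prop where
  falsum {n : ℕ} (h : ⟨n, .falsum⟩ ∈ F) (x : Fin n → A) : ¬ Structure.RelMap (formulaSymbol h) x
  equal {n : ℕ} {t s : L.Term (Fin n)} (h : ⟨n, .equal t s⟩ ∈ F) (x : Fin n → A) :
    Structure.RelMap (formulaSymbol h) x ↔
      ((LHom.sumInl (L' := fragmentLanguage F)).onTerm t).realize x =
        ((LHom.sumInl (L' := fragmentLanguage F)).onTerm s).realize x
  rel {n l : ℕ} {R : L.Relations l} {ts : Fin l → L.Term (Fin n)} (h : ⟨n, .rel R ts⟩ ∈ F)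
    (x : Fin n → A) :
    Structure.RelMap (formulaSymbol h) x ↔
      Structure.RelMap ((LHom.sumInl (L' := fragmentLanguage F)).onRelation R)
        fun i => ((LHom.sumInl (L' := fragmentLanguage F)).onTerm (ts i)).realize x
  imp {n : ℕ} {φ ψ : InfFormula L n} (h : ⟨n, .imp φ ψ⟩ ∈ F) (hφ : ⟨n, φ⟩ ∈ F) (hψ : ⟨n, ψ⟩ ∈ F)
    (x : Fin n → A) :
    Structure.RelMap (formulaSymbol h) x ↔
      (Structure.RelMap (formulaSymbol hφ) x → Structure.RelMap (formulaSymbol hψ) x)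
  all {n : ℕ} {φ : InfFormula L (n + 1)} (h : ⟨n, .all φ⟩ ∈ F) (hφ : ⟨n + 1, φ⟩ ∈ F)
    (x : Fin n → A) (a : A) :
    Structure.RelMap (formulaSymbol h) x →
      Structure.RelMap (formulaSymbol hφ) (Fin.snoc x a : Fin (n + 1) → A)
  skolem {n : ℕ} {φ : InfFormula L (n + 1)} (h : ⟨n, .all φ⟩ ∈ F) (hφ : ⟨n + 1, φ⟩ ∈ F)
    (x : Fin n → A) :
    Structure.RelMap (formulaSymbol hφ)
        (Fin.snoc x (Structure.funMap (skolemSymbol hφ) x) : Fin (n + 1) → A) →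
      Structure.RelMap (formulaSymbol h) x
  conj {n : ℕ} {φ : ℕ → InfFormula L n} (h : ⟨n, .conj φ⟩ ∈ F) (i : ℕ) (hφ : ⟨n, φ i⟩ ∈ F)
    (x : Fin n → A) :
    Structure.RelMap (formulaSymbol h) x → Structure.RelMap (formulaSymbol hφ) x

/-- The relation symbol of a conjunction holds wherever those of its members hold. -/
def ObeysConj (A : Type w) [(expandedLanguage F).Structure A] : Prop :=
  ∀ {n : ℕ} {φ : ℕ → InfFormula L n} (h : ⟨n, .conj φ⟩ ∈ F) (hφ : ∀ i, ⟨n, φ i⟩ ∈ F) (x : Fin n → A),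
    (∀ i, Structure.RelMap (formulaSymbol (hφ i)) x) → Structure.RelMap (formulaSymbol h) x

variable {F}

/-- Induction on formulas. The Skolem function gives the converse direction for `all`, and
`ObeysConj` the one for `conj`. -/
theorem ObeysUniversal.relMap_iff {A : Type w} [L.Structure A] [(expandedLanguage F).Structure A]
    [(LHom.sumInl (L := L) (L' := fragmentLanguage F)).IsExpansionOn A] (hF : IsFragment F)
    (hA : ObeysUniversal F A) (hA' : ObeysConj F A) {n : ℕ} {φ : InfFormula L n}
    (h : ⟨n, φ⟩ ∈ F) (x : Fin n → A) :
    Structure.RelMap (formulaSymbol h) x ↔ φ.Realize x := by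
  induction φ with
  | falsum => exact iff_of_false (hA.falsum h x) id
  | equal t s => rw [hA.equal, LHom.realize_onTerm, LHom.realize_onTerm]; rfl
  | rel R ts => rw [hA.rel, LHom.map_onRelation]; simp only [LHom.realize_onTerm]; rfl
  | imp φ ψ ih ih' =>
    rw [hA.imp h (hF.imp_left h) (hF.imp_right h), ih (hF.imp_left h), ih' (hF.imp_right h)]; rfl
  | all φ ih =>
    refine ⟨fun H a => (ih (hF.all h) _).1 (hA.all h (hF.all h) x a H), fun H => ?_⟩
    exact hA.skolem h (hF.all h) x ((ih (hF.all h) _).2 (H _))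
  | conj φ ih =>
    refine ⟨fun H i => (ih i (hF.conj h i) _).1 (hA.conj h i (hF.conj h i) x H), fun H => ?_⟩
    exact hA' h (hF.conj h) x fun i => (ih i (hF.conj h i) _).2 (H i)

/-- Thanks to the Skolem functions every clause is universal over quantifier-free formulas, so it
passes to substructures. -/
theorem ObeysUniversal.of_embedding {A : Type v} {B : Type w} [(expandedLanguage F).Structure A]
    [(expandedLanguage F).Structure B] (g : A ↪[expandedLanguage F] B)
    (hB : ObeysUniversal F B) : ObeysUniversal F A where
  falsum h x := by rw [← g.map_rel]; exact hB.falsum h _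
  equal h x := by
    rw [← g.map_rel, hB.equal, HomClass.realize_term, HomClass.realize_term, g.injective.eq_iff]
  rel h x := by
    rw [← g.map_rel, hB.rel, ← g.map_rel]
    simp only [HomClass.realize_term]
    rfl
  imp h hφ hψ x := by simp only [← g.map_rel, hB.imp h hφ hψ]
  all h hφ x a := by
    rw [← g.map_rel, ← g.map_rel, Fin.comp_snoc]
    exact hB.all h hφ _ _
  skolem h hφ x := by
    rw [← g.map_rel, ← g.map_rel, Fin.comp_snoc, g.map_fun]
    exact hB.skolem h hφ _
  conj h i hφ x := by
    rw [← g.map_rel, ← g.map_rel]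
    exact hB.conj h i hφ _

theorem ObeysConj.of_embedding {A : Type v} {B : Type w} [(expandedLanguage F).Structure A]
    [(expandedLanguage F).Structure B] (g : A ↪[expandedLanguage F] B)
    (hB : ObeysConj F B) : ObeysConj F A := fun h hφ x => by
  simp only [← g.map_rel]
  exact hB h hφ _

variable (F)

/-- The expansion of an `L`-structure by satisfaction relations and Skolem functions. -/
@[reducible]
noncomputable def fragmentStructure (M : Type w) [L.Structure M] [Nonempty M] :
    (fragmentLanguage F).Structure M where
  funMap φ x := Classical.epsilon fun a => ¬ φ.1.Realize (Fin.snoc x a)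
  RelMap φ x := φ.1.Realize x

attribute [local instance] fragmentStructure

theorem relMap_fragmentStructure {F : Set (Σ n, InfFormula L n)}
    {M : Type w} [L.Structure M] [Nonempty M] {n : ℕ} {φ : InfFormula L n}
    (h : ⟨n, φ⟩ ∈ F) (x : Fin n → M) :
    Structure.RelMap (formulaSymbol h) x ↔ φ.Realize x := Iff.rfl

theorem obeysUniversal_fragmentStructure (M : Type w) [L.Structure M] [Nonempty M] :
    ObeysUniversal F M where
  falsum h x := id
  equal h x := by
    rw [relMap_fragmentStructure, LHom.realize_onTerm, LHom.realize_onTerm]; rfl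
  rel h x := by
    rw [relMap_fragmentStructure, LHom.map_onRelation]; simp only [LHom.realize_onTerm]; rfl
  imp h hφ hψ x := Iff.rfl
  all h hφ x a H := H a
  skolem {n φ} h hφ x H := by
    rw [relMap_fragmentStructure] at H ⊢
    by_contra hn
    simp only [InfFormula.Realize, not_forall] at hn
    exact Classical.epsilon_spec hn H
  conj h i hφ x H := H i

theorem obeysConj_fragmentStructure (M : Type w) [L.Structure M] [Nonempty M] :
    ObeysConj F M := fun _ _ _ H => H

end Skolem

end HanfContinuum

namespace HanfContinuum

open FirstOrder FirstOrder.Language Set Filter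

/-! ### Large ranks from the cardinal hypothesis -/

section RankExtraction

theorem exists_splittingRankGE {L : FirstOrder.Language.{u, v}} {M : Type w} [L.Structure M]
    (h : ((ω₁ : Ordinal.{w}) : WithTop Ordinal.{w}) ≤ structureSplittingRank L M)
    {α : Ordinal.{w}} (hα : α < ω₁) :
    ∃ B : Set M, B.Finite ∧ B.Nonempty ∧ SplittingRankGE L α B := by
  -- The supremum is over `sprk(B) + 1`, so it must be compared with `α + 1` to find `B` of rank
  -- above `α`.
  have hα' : α + 1 < ω₁ := (Cardinal.isSuccLimit_omega 1).add_one_lt hα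
  have := (WithTop.coe_lt_coe.2 hα').trans_le h
  rw [structureSplittingRank, lt_sSup_iff] at this
  obtain ⟨_, ⟨B, hfin, hB, -, rfl⟩, hlt⟩ := this
  have hlt' : (α : WithTop Ordinal.{w}) < splittingRank L B := by
    rw [WithTop.coe_add, WithTop.coe_one] at hlt
    exact lt_of_add_lt_add_right hlt
  rw [splittingRank, lt_sSup_iff] at hlt'
  obtain ⟨_, ⟨γ, hγ, rfl⟩, hlt⟩ := hlt'
  exact ⟨B, hfin, hB, hγ.anti_right (WithTop.coe_lt_coe.1 hlt).le hB⟩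

/-- In a finite structure the whole universe is a finite definable set, so every element is
algebraic and no non-empty `B` has rank at least `0`. -/
theorem ForcesSplitting.aleph0_le {κ : Cardinal.{w}} (h : ForcesSplitting κ) : ℵ₀ ≤ κ := by
  by_contra! hκ
  let _ : FirstOrder.Language.empty.Structure κ.out := {}
  obtain ⟨B, -, ⟨b, hb⟩, hr⟩ := exists_splittingRankGE
    (h FirstOrder.Language.empty inferInstance κ.out κ.mk_out) (Ordinal.omega_pos 1)
  rw [splittingRankGE_zero] at hr
  have : Finite κ.out := by
    rw [← Cardinal.mk_lt_aleph0_iff, κ.mk_out]; exact hκ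
  refine (hr.subset ⟨hb, Set.univ, ?_, Set.toFinite _, trivial⟩ : b ∈ (∅ : Set κ.out))
  exact Set.definable_univ

theorem exists_forcesSplitting_of_le {μ : Cardinal.{w}}
    (h : lambdaOmegaOne.{w} ≤ (μ : WithTop Cardinal.{w})) : ∃ κ ≤ μ, ForcesSplitting κ := by
  rw [lambdaOmegaOne] at h
  have hne : {x : WithTop Cardinal.{w} |
      ∃ κ : Cardinal.{w}, ForcesSplitting κ ∧ x = (κ : WithTop Cardinal.{w})}.Nonempty := by
    by_contra hne
    rw [not_nonempty_iff_eq_empty] at hne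
    rw [hne, sInf_empty] at h
    exact absurd h (by simp)
  obtain ⟨κ, hκ, e⟩ := csInf_mem hne
  rw [e] at h
  exact ⟨κ, WithTop.coe_le_coe.1 h, hκ⟩

end RankExtraction

/-! ### Terms in finitely many variables -/

section Terms

variable {L : FirstOrder.Language.{u, v}}

theorem relabel_restrictVar {α β : Type*} [DecidableEq α] (t : L.Term α) (f : t.varFinset → β)
    (g : β → α) (h : ∀ x, g (f x) = x) : (t.restrictVar f).relabel g = t := by
  induction t with
  | var a => exact congrArg Term.var (h _)
  | func F ts ih =>
    simp only [Term.restrictVar, Term.relabel, Term.func.injEq, heq_eq_eq, true_and]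
    funext i
    exact ih i _ fun x => h _

/-- Injectivity of `η` matters: the tree decides covers only at tuples of distinct nodes. -/
theorem exists_eq_relabel {ι α : Type*} [Finite ι] (t : ι → L.Term α) :
    ∃ (k : ℕ) (η : Fin k → α) (s : ι → L.Term (Fin k)), Function.Injective η ∧
      ∀ i, t i = (s i).relabel η := by
  classical
  have := Fintype.ofFinite ι
  let V : Finset α := Finset.univ.biUnion fun i => (t i).varFinset
  have hV : ∀ i, ∀ x ∈ (t i).varFinset, x ∈ V := fun i x hx =>
    Finset.mem_biUnion.2 ⟨i, Finset.mem_univ i, hx⟩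
  refine ⟨V.card, fun j => V.equivFin.symm j,
    fun i => (t i).restrictVar fun x => V.equivFin ⟨x, hV i x x.2⟩,
    Subtype.val_injective.comp V.equivFin.symm.injective, fun i => ?_⟩
  rw [relabel_restrictVar]
  simp

theorem isQF_subst {α β : Type*} {n : ℕ} {φ : L.BoundedFormula α n} (hφ : φ.IsQF)
    (t : α → L.Term β) : (φ.subst t).IsQF := by
  induction hφ with
  | falsum => exact BoundedFormula.IsQF.falsum
  | of_isAtomic h =>
    cases h with
    | equal => exact (BoundedFormula.IsAtomic.equal _ _).isQF
    | rel => exact (BoundedFormula.IsAtomic.rel _ _).isQF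
  | imp _ _ h h' => exact h.imp h'

theorem isAtomic_onBoundedFormula {L' : FirstOrder.Language.{u, v}} (f : L →ᴸ L') {α : Type*} {n : ℕ}
    {φ : L.BoundedFormula α n} (hφ : φ.IsAtomic) : (f.onBoundedFormula φ).IsAtomic := by
  cases hφ with
  | equal => exact BoundedFormula.IsAtomic.equal _ _
  | rel => exact BoundedFormula.IsAtomic.rel _ _

end Terms

/-! ### Ultrapowers -/

section Ultraproduct

variable {K : FirstOrder.Language.{u, v}} {A : Type w} [K.Structure A]

/-- The ultrapower of `A` by a non-principal ultrafilter on `ℕ`. -/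
abbrev Ultrapower (A : Type w) : Type w := (hyperfilter ℕ : Filter ℕ).Product fun _ => A

/-- The class of a sequence in the ultrapower. -/
noncomputable def Ultrapower.mk (x : ℕ → A) : Ultrapower A := Quotient.mk'' x

theorem Ultrapower.exists_rep {ι : Type*} (x : ι → Ultrapower A) :
    ∃ y : ι → ℕ → A, x = fun i => Ultrapower.mk (y i) := by
  choose y hy using fun i => Quotient.exists_rep (x i)
  exact ⟨y, funext fun i => (hy i).symm⟩

theorem Ultrapower.mk_eq_mk {x y : ℕ → A} :
    Ultrapower.mk x = Ultrapower.mk y ↔ ∀ᶠ l in hyperfilter ℕ, x l = y l := Quotient.eq''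

theorem Ultrapower.relMap_mk {n : ℕ} (R : K.Relations n) (x : Fin n → ℕ → A) :
    Structure.RelMap R (fun i => Ultrapower.mk (x i)) ↔
      ∀ᶠ l in hyperfilter ℕ, Structure.RelMap R fun i => x i l :=
  relMap_quotient_mk' ..

theorem Ultrapower.funMap_mk {n : ℕ} (f : K.Functions n) (x : Fin n → ℕ → A) :
    Structure.funMap f (fun i => Ultrapower.mk (x i)) =
      Ultrapower.mk fun l => Structure.funMap f fun i => x i l :=
  Ultraproduct.funMap_cast f x

theorem Ultrapower.realize_term_mk {β : Type*} (t : K.Term β) (x : β → ℕ → A) :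
    t.realize (fun i => Ultrapower.mk (x i)) = Ultrapower.mk fun l => t.realize fun i => x i l :=
  Ultraproduct.term_realize_cast x t

theorem Ultrapower.realize_formula_mk [Nonempty A] {β : Type*} (φ : K.Formula β)
    (x : β → ℕ → A) :
    φ.Realize (fun i => Ultrapower.mk (x i)) ↔
      ∀ᶠ l in hyperfilter ℕ, φ.Realize fun i => x i l :=
  Ultraproduct.realize_formula_cast φ x

theorem Ultrapower.snoc_mk {n : ℕ} (x : Fin n → ℕ → A) (a : ℕ → A) :
    (Fin.snoc (fun i => Ultrapower.mk (x i)) (Ultrapower.mk a) : Fin (n + 1) → Ultrapower A) =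
      fun i => Ultrapower.mk fun l => (Fin.snoc (fun i => x i l) (a l) : Fin (n + 1) → A) i := by
  funext i
  refine Fin.lastCases ?_ (fun i => ?_) i <;> simp

end Ultraproduct

/-- Łoś's theorem applies clause by clause, since each clause involves finitely many symbols.
`ObeysConj` is not of this form. -/
theorem ObeysUniversal.ultrapower {L : FirstOrder.Language.{0, 0}} {F : Set (Σ n, InfFormula L n)}
    {A : Type w} [(expandedLanguage F).Structure A] (hA : ObeysUniversal F A) :
    ObeysUniversal F (Ultrapower A) where
  falsum h x := by
    obtain ⟨x, rfl⟩ := Ultrapower.exists_rep x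
    rw [Ultrapower.relMap_mk]
    simp only [hA.falsum h, eventually_false_iff_eq_bot]
    exact (hyperfilter ℕ).neBot.ne
  equal h x := by
    obtain ⟨x, rfl⟩ := Ultrapower.exists_rep x
    rw [Ultrapower.relMap_mk, Ultrapower.realize_term_mk, Ultrapower.realize_term_mk,
      Ultrapower.mk_eq_mk]
    simp only [hA.equal]
  rel h x := by
    obtain ⟨x, rfl⟩ := Ultrapower.exists_rep x
    simp only [Ultrapower.realize_term_mk]
    rw [Ultrapower.relMap_mk, Ultrapower.relMap_mk]
    simp only [hA.rel]
  imp h hφ hψ x := by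
    obtain ⟨x, rfl⟩ := Ultrapower.exists_rep x
    rw [Ultrapower.relMap_mk, Ultrapower.relMap_mk, Ultrapower.relMap_mk,
      ← Ultrafilter.eventually_imp]
    simp only [hA.imp h hφ hψ]
  all h hφ x a := by
    obtain ⟨x, rfl⟩ := Ultrapower.exists_rep x
    obtain ⟨a, rfl⟩ := Quotient.exists_rep a
    change _ → Structure.RelMap _ (Fin.snoc _ (Ultrapower.mk a) : Fin (_ + 1) → Ultrapower A)
    rw [Ultrapower.snoc_mk, Ultrapower.relMap_mk, Ultrapower.relMap_mk]
    exact fun H => H.mono fun l hl => hA.all h hφ _ _ hl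
  skolem h hφ x := by
    obtain ⟨x, rfl⟩ := Ultrapower.exists_rep x
    rw [Ultrapower.funMap_mk, Ultrapower.snoc_mk, Ultrapower.relMap_mk, Ultrapower.relMap_mk]
    exact fun H => H.mono fun l hl => hA.skolem h hφ _ hl
  conj h i hφ x := by
    obtain ⟨x, rfl⟩ := Ultrapower.exists_rep x
    rw [Ultrapower.relMap_mk, Ultrapower.relMap_mk]
    exact fun H => H.mono fun l hl => hA.conj h i hφ _ hl

end HanfContinuum

namespace HanfContinuum

open FirstOrder FirstOrder.Language Set Filter

/-! ### Countable trees that decide all tasks -/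

/-- The substructure generated by the tree is countable, so it has a copy in `Type`; quantifier-free
decisions are reflected by the embedding. Countability of `A` later makes every function on it
measurable. -/
theorem exists_countable_tree {K : FirstOrder.Language.{0, 0}} [Countable (Σ l, K.Functions l)]
    {M : Type u} [K.Structure M] {T : Type} [Countable T] [Nonempty T] (k : T → ℕ)
    (Q : ∀ t, ℕ → K.Formula (Fin (k t))) (hQ : ∀ t i, BoundedFormula.IsQF (Q t i))
    (cover : ∀ t (x : Fin (k t) → M), ∃ i, (Q t i).Realize x)
    (hM : ∀ α < (ω₁ : Ordinal.{u}), ∃ B : Set M, B.Nonempty ∧ SplittingRankGE K α B) :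
    ∃ (A : Type) (_ : K.Structure A) (_ : Countable A) (_ : A ↪[K] M) (b : ∀ l, (Fin l → Bool) → A),
      (∀ l, Function.Injective (b l)) ∧
      ∀ t, ∃ n, ∀ l ≥ n, ∀ e : Fin (k t) → Fin l → Bool, Function.Injective e →
        ∃ i, ∀ l' ≥ l, ∀ η : Fin (k t) → ℕ → Bool, (∀ j, cut l (η j) = e j) →
          (Q t i).Realize fun j => b l' (cut l' (η j)) := by
  obtain ⟨b, hb, hdec⟩ := exists_tree (L := K) (M := M) k Q hQ cover hM
  let X : Set M := ⋃ l, range (b l)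
  have hX : X.Countable := countable_iUnion fun l => countable_range _
  let C := Substructure.closure K X
  have hC : Countable C := hX.substructure_closure K
  have hbC : ∀ l s, b l s ∈ C := fun l s =>
    Substructure.subset_closure (mem_iUnion.2 ⟨l, mem_range_self s⟩)
  let e : C ≃ Shrink.{0} C := equivShrink C
  let _ : K.Structure (Shrink.{0} C) := e.inducedStructure
  let g : Shrink.{0} C ↪[K] M :=
    C.subtype.comp (_root_.Equiv.inducedStructureEquiv (L := K) e).symm.toEmbedding
  have hg : ∀ l s, g (e ⟨b l s, hbC l s⟩) = b l s := fun l s => by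
    change ((e.symm (e ⟨b l s, hbC l s⟩) : C) : M) = b l s
    rw [e.symm_apply_apply]
  refine ⟨Shrink.{0} C, inferInstance, e.symm.injective.countable, g, fun l s => e ⟨b l s, hbC l s⟩,
    fun l s s' h => hb l (by simpa using h), fun t => ?_⟩
  obtain ⟨n, hn⟩ := hdec t
  refine ⟨n, fun l hl f hf => ?_⟩
  obtain ⟨i, hi⟩ := hn l hl f hf
  refine ⟨i, fun l' hl' η hη => ?_⟩
  have := hi l' hl' η hη
  have he : (fun j => b l' (cut l' (η j))) = g ∘ fun j => e ⟨b l' (cut l' (η j)), hbC _ _⟩ :=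
    funext fun j => (hg _ _).symm
  rw [he] at this
  refine ((hQ t i).realize_embedding g (xs := default)).1 ?_
  rwa [Unique.eq_default (g ∘ default)]

section Tasks

variable {L : FirstOrder.Language.{0, 0}}

/-- The families of formulas to be decided along the tree: a quantifier-free formula and its
negation, or the reason why a conjunction of the fragment fails at a tuple of terms. -/
abbrev Task (F : Set (Σ n, InfFormula L n)) : Type :=
  (Σ k : ℕ, {θ : (expandedLanguage F).Formula (Fin k) // BoundedFormula.IsQF θ}) ⊕
    Σ (p : {p : Σ m, ℕ → InfFormula L m // ⟨p.1, .conj p.2⟩ ∈ F}) (k : ℕ),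
      Fin p.1.1 → (expandedLanguage F).Term (Fin k)

variable {F : Set (Σ n, InfFormula L n)}

/-- The number of variables of a task. -/
def Task.arity : Task F → ℕ
  | .inl θ => θ.1
  | .inr t => t.2.1

open scoped Classical in
/-- The family of formulas of a task. -/
noncomputable def Task.cover (hF : IsFragment F) :
    ∀ t : Task F, ℕ → (expandedLanguage F).Formula (Fin t.arity)
  | .inl θ, i => if i = 0 then θ.2.1 else θ.2.1.not
  | .inr t, i => (formulaSymbol t.1.2).formula t.2.2 ⊔
      ((formulaSymbol (hF.conj t.1.2 i)).formula t.2.2).not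

theorem Task.isQF_cover (hF : IsFragment F) (t : Task F) (i : ℕ) :
    BoundedFormula.IsQF (t.cover hF i) := by
  rcases t with ⟨k, θ, hθ⟩ | ⟨p, k, t⟩
  · change BoundedFormula.IsQF (if i = 0 then θ else θ.not)
    split_ifs
    exacts [hθ, hθ.not]
  · exact (BoundedFormula.IsAtomic.rel _ _).isQF.sup (BoundedFormula.IsAtomic.rel _ _).isQF.not

section

variable {A : Type w} [(expandedLanguage F).Structure A]

theorem Task.realize_cover_inl (hF : IsFragment F)
    (θ : Σ k : ℕ, {θ : (expandedLanguage F).Formula (Fin k) // BoundedFormula.IsQF θ}) (i : ℕ)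
    (x : Fin θ.1 → A) :
    (Task.cover hF (.inl θ) i).Realize x ↔ (i = 0 ↔ θ.2.1.Realize x) := by
  change (if i = 0 then θ.2.1 else θ.2.1.not).Realize x ↔ _
  split_ifs with h <;> simp [h]

theorem Task.realize_cover_inr (hF : IsFragment F)
    (t : Σ (p : {p : Σ m, ℕ → InfFormula L m // ⟨p.1, .conj p.2⟩ ∈ F}) (k : ℕ),
      Fin p.1.1 → (expandedLanguage F).Term (Fin k)) (i : ℕ) (x : Fin t.2.1 → A) :
    (Task.cover hF (.inr t) i).Realize x ↔
      (Structure.RelMap (formulaSymbol (hF.conj t.1.2 i)) (fun j => (t.2.2 j).realize x) →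
        Structure.RelMap (formulaSymbol t.1.2) fun j => (t.2.2 j).realize x) := by
  change ((formulaSymbol t.1.2).formula t.2.2 ⊔
      ((formulaSymbol (hF.conj t.1.2 i)).formula t.2.2).not).Realize x ↔ _
  rw [Formula.realize_sup, Formula.realize_not, Formula.realize_rel, Formula.realize_rel,
    imp_iff_or_not]

/-- If no member of the second kind of cover held, all members of the conjunction would be true and
the conjunction false, against `ObeysConj`. -/
theorem Task.exists_cover (hF : IsFragment F)
    (hA : ObeysConj F A) (t : Task F) (x : Fin t.arity → A) : ∃ i, (t.cover hF i).Realize x := by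
  rcases t with θ | t
  · by_cases h : θ.2.1.Realize x
    · exact ⟨0, (Task.realize_cover_inl hF θ 0 x).2 (iff_of_true rfl h)⟩
    · exact ⟨1, (Task.realize_cover_inl hF θ 1 x).2 (iff_of_false one_ne_zero h)⟩
  · by_contra! H
    have H' := fun i => Classical.not_imp.1 ((Task.realize_cover_inr hF t i x).not.1 (H i))
    exact (H' 0).2 (hA t.1.2 (hF.conj t.1.2) _ fun i => (H' i).1)

end

theorem Task.countable [Countable L.Symbols] (hF : F.Countable) : Countable (Task F) := by
  have := countable_expandedLanguage F hF
  have := hF.to_subtype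
  have h₁ : Countable {p : Σ m, ℕ → InfFormula L m // ⟨p.1, .conj p.2⟩ ∈ F} :=
    Function.Injective.countable (β := F) (f := fun p => ⟨⟨p.1.1, .conj p.1.2⟩, p.2⟩) (by
      rintro ⟨⟨n, φ⟩, hφ⟩ ⟨⟨m, ψ⟩, hψ⟩ h
      simp only [Subtype.mk.injEq, Sigma.mk.injEq] at h
      obtain ⟨rfl, h⟩ := h
      cases h; rfl)
  have h₂ : Countable (Σ l, (expandedLanguage F).Functions l) :=
    Function.Injective.countable (β := (expandedLanguage F).Symbols) Sum.inl_injective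
  infer_instance

end Tasks

/-- A tree of elements of `A` that decides all tasks of the fragment. -/
structure DecidingTree {L : FirstOrder.Language.{0, 0}} {F : Set (Σ n, InfFormula L n)}
    (hF : IsFragment F) (A : Type w) [(expandedLanguage F).Structure A] where
  /-- The elements at the nodes of the tree. -/
  node : ∀ l, (Fin l → Bool) → A
  injective : ∀ l, Function.Injective (node l)
  decides : ∀ t : Task F, ∃ n, ∀ l ≥ n, ∀ e : Fin t.arity → Fin l → Bool, Function.Injective e →
    ∃ i, ∀ l' ≥ l, ∀ η : Fin t.arity → ℕ → Bool, (∀ j, cut l (η j) = e j) →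
      (t.cover hF i).Realize fun j => node l' (cut l' (η j))

theorem exists_cut_injective {k : ℕ} {η : Fin k → ℕ → Bool} (hη : Function.Injective η) :
    ∃ l, Function.Injective fun i => cut l (η i) := by
  have : ∀ p : Fin k × Fin k, ∃ l, p.1 ≠ p.2 → cut l (η p.1) ≠ cut l (η p.2) := by
    rintro ⟨i, j⟩
    by_cases h : i = j
    · exact ⟨0, fun h' => absurd h h'⟩
    · obtain ⟨m, hm⟩ := Function.ne_iff.1 (hη.ne h)
      exact ⟨m + 1, fun _ e => hm (congrFun e ⟨m, Nat.lt_succ_self m⟩)⟩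
  choose l hl using this
  refine ⟨Finset.univ.sup l, fun i j hij => by_contra fun h => hl (i, j) h ?_⟩
  ext m
  exact congrFun hij ⟨m, m.2.trans_le (Finset.le_sup (Finset.mem_univ (i, j)))⟩

/-! ### The hull of the branches -/

namespace DecidingTree

variable {L : FirstOrder.Language.{0, 0}} {F : Set (Σ n, InfFormula L n)} {hF : IsFragment F}
  {A : Type w} [(expandedLanguage F).Structure A] (b : DecidingTree hF A)

/-- The element that approximates the branch `η` at level `l`. -/
def approx (l : ℕ) (η : ℕ → Bool) : A := b.node l (cut l η)

theorem exists_similar {k : ℕ} (θ : (expandedLanguage F).Formula (Fin k))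
    (hθ : BoundedFormula.IsQF θ) :
    ∃ n, ∀ l ≥ n, ∀ η τ : Fin k → ℕ → Bool, SimilarMod l η τ → ∀ l₁ ≥ l, ∀ l₂ ≥ l,
      (θ.Realize (fun j => b.approx l₁ (η j)) ↔ θ.Realize fun j => b.approx l₂ (τ j)) := by
  obtain ⟨n, hn⟩ := b.decides (.inl ⟨k, θ, hθ⟩)
  refine ⟨n, fun l hl η τ h l₁ hl₁ l₂ hl₂ => ?_⟩
  obtain ⟨i, hi⟩ := hn l hl (fun j => cut l (η j)) h.1
  have h₁ := hi l₁ hl₁ η fun _ => rfl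
  have h₂ := hi l₂ hl₂ τ fun j => by
    ext m; exact (h.2 j m m.2).symm
  exact ((Task.realize_cover_inl hF ⟨k, θ, hθ⟩ i _).1 h₁).symm.trans
    ((Task.realize_cover_inl hF ⟨k, θ, hθ⟩ i _).1 h₂)

/-- Rewrite the terms over distinct branches and substitute them into `θ`. Once the branches have
separated and the task is decided, the truth value no longer changes. -/
theorem eventually_or_eventually_not {ι : Type*} [Finite ι] (θ : (expandedLanguage F).Formula ι)
    (hθ : BoundedFormula.IsQF θ) (t : ι → (expandedLanguage F).Term (ℕ → Bool)) :
    (∀ᶠ l in atTop, θ.Realize fun i => (t i).realize (b.approx l)) ∨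
      ∀ᶠ l in atTop, ¬ θ.Realize fun i => (t i).realize (b.approx l) := by
  obtain ⟨k, η, s, hη, hs⟩ := exists_eq_relabel t
  obtain ⟨n, hn⟩ := b.exists_similar (BoundedFormula.subst θ s) (isQF_subst hθ s)
  obtain ⟨m, hm⟩ := exists_cut_injective hη
  have key : ∀ l, (θ.Realize fun i => (t i).realize (b.approx l)) ↔
      Formula.Realize (BoundedFormula.subst θ s) fun j => b.approx l (η j) := fun l => by
    simp only [Formula.Realize, BoundedFormula.realize_subst, hs, Term.realize_relabel]
    rfl
  simp only [key]
  have H : ∀ l ≥ max n m, (Formula.Realize (BoundedFormula.subst θ s) fun j => b.approx l (η j)) ↔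
      Formula.Realize (BoundedFormula.subst θ s) fun j => b.approx (max n m) (η j) := fun l hl =>
    hn (max n m) (le_max_left _ _) η η
      ⟨cut_injective_mono (le_max_right n m) hm, fun _ _ _ => rfl⟩ l hl _ le_rfl
  by_cases h : Formula.Realize (BoundedFormula.subst θ s) fun j => b.approx (max n m) (η j)
  · exact .inl (eventually_atTop.2 ⟨_, fun l hl => (H l hl).2 h⟩)
  · exact .inr (eventually_atTop.2 ⟨_, fun l hl => mt (H l hl).1 h⟩)

/-- Truth values stabilize, so the ultrafilter can be replaced by `atTop`. This makes truth in the
hull a Borel condition. -/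
theorem eventually_hyperfilter {ι : Type*} [Finite ι] (θ : (expandedLanguage F).Formula ι)
    (hθ : BoundedFormula.IsQF θ) (t : ι → (expandedLanguage F).Term (ℕ → Bool)) :
    (∀ᶠ l in hyperfilter ℕ, θ.Realize fun i => (t i).realize (b.approx l)) ↔
      ∀ᶠ l in atTop, θ.Realize fun i => (t i).realize (b.approx l) := by
  have hle : (hyperfilter ℕ : Filter ℕ) ≤ atTop := by
    rw [← Nat.cofinite_eq_atTop]; exact hyperfilter_le_cofinite
  refine ⟨fun h => ?_, fun h => hle h⟩
  refine (b.eventually_or_eventually_not θ hθ t).resolve_right fun h' => ?_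
  obtain ⟨l, h₁, h₂⟩ := (h.and (hle h')).exists
  exact h₂ h₁

/-- The point is that one `i` serves all large levels, since the tree has decided the cover above
the cuts of these branches. -/
theorem exists_eventually_conj {m : ℕ} {φ : ℕ → InfFormula L m} (h : ⟨m, .conj φ⟩ ∈ F)
    (t : Fin m → (expandedLanguage F).Term (ℕ → Bool)) :
    ∃ i, ∀ᶠ l in atTop,
      Structure.RelMap (formulaSymbol (hF.conj h i)) (fun j => (t j).realize (b.approx l)) →
        Structure.RelMap (formulaSymbol h) fun j => (t j).realize (b.approx l) := by
  obtain ⟨k, η, s, hη, hs⟩ := exists_eq_relabel t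
  obtain ⟨n, hn⟩ := b.decides (.inr ⟨⟨⟨m, φ⟩, h⟩, k, s⟩)
  obtain ⟨m', hm⟩ := exists_cut_injective hη
  obtain ⟨i, hi⟩ := hn (max n m') (le_max_left _ _) (fun j => cut _ (η j))
    (cut_injective_mono (le_max_right n m') hm)
  refine ⟨i, eventually_atTop.2 ⟨max n m', fun l hl => ?_⟩⟩
  simp only [hs, Term.realize_relabel]
  exact (Task.realize_cover_inr hF ⟨⟨⟨m, φ⟩, h⟩, k, s⟩ i _).1 (hi l hl η fun _ => rfl)

/-- The element of the ultrapower determined by a branch. -/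
noncomputable def branch (η : ℕ → Bool) : Ultrapower A := .mk fun l => b.approx l η

theorem branch_injective : Function.Injective b.branch := by
  intro η τ h
  by_contra hne
  obtain ⟨m, hm⟩ := Function.ne_iff.1 hne
  have hle : (hyperfilter ℕ : Filter ℕ) ≤ atTop := by
    rw [← Nat.cofinite_eq_atTop]; exact hyperfilter_le_cofinite
  obtain ⟨l, h₁, h₂⟩ := ((Ultrapower.mk_eq_mk.1 h).and (hle (eventually_gt_atTop m))).exists
  exact hm (congrFun (b.injective l h₁) ⟨m, h₂⟩)

theorem realize_branch (t : (expandedLanguage F).Term (ℕ → Bool)) :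
    t.realize b.branch = Ultrapower.mk fun l => t.realize (b.approx l) :=
  Ultrapower.realize_term_mk t fun η l => b.approx l η

/-- The substructure of the ultrapower generated by the branches. -/
noncomputable def hull : (expandedLanguage F).Substructure (Ultrapower A) :=
  Substructure.closure _ (range b.branch)

/-- The value of a term at a tuple of branches. -/
noncomputable def value (t : (expandedLanguage F).Term (ℕ → Bool)) : b.hull :=
  ⟨t.realize b.branch, t.realize_mem _ fun η => Substructure.subset_closure (mem_range_self η)⟩

theorem value_surjective : Function.Surjective b.value := by
  rintro ⟨x, hx⟩
  obtain ⟨t, ht⟩ := Substructure.mem_closure_iff_exists_term.1 hx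
  choose f hf using fun y : range b.branch => y.2
  refine ⟨t.relabel f, Subtype.ext ?_⟩
  change (t.relabel f).realize b.branch = x
  rw [← ht, Term.realize_relabel]
  congr 1
  funext y
  exact hf y

theorem realize_value_iff {ι : Type*} [Finite ι] (θ : (expandedLanguage F).Formula ι)
    (hθ : BoundedFormula.IsQF θ) (t : ι → (expandedLanguage F).Term (ℕ → Bool)) :
    (θ.Realize fun i => b.value (t i)) ↔
      ∀ᶠ l in atTop, θ.Realize fun i => (t i).realize (b.approx l) := by
  have : Nonempty A := ⟨b.node 0 default⟩
  rw [← b.eventually_hyperfilter θ hθ t, ← Ultrapower.realize_formula_mk]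
  simp only [← b.realize_branch]
  have := hθ.realize_embedding b.hull.subtype (v := fun i => b.value (t i)) (xs := default)
  rw [Unique.eq_default (b.hull.subtype ∘ default)] at this
  exact this.symm

theorem relMap_value_iff {n : ℕ} (R : (expandedLanguage F).Relations n)
    (t : Fin n → (expandedLanguage F).Term (ℕ → Bool)) :
    (Structure.RelMap R fun i => b.value (t i)) ↔
      ∀ᶠ l in atTop, Structure.RelMap R fun i => (t i).realize (b.approx l) := by
  have := b.realize_value_iff (R.formula fun i => Term.var i)
    (BoundedFormula.IsAtomic.rel _ _).isQF t
  simpa only [Formula.realize_rel, Term.realize_var] using this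

theorem obeysUniversal_hull (hA : ObeysUniversal F A) : ObeysUniversal F b.hull :=
  hA.ultrapower.of_embedding b.hull.subtype

/-- Only the member `i` decided for this tuple of terms is needed: it holds eventually, hence so
does the conjunction. -/
theorem obeysConj_hull : ObeysConj F b.hull := by
  intro n φ h hφ x H
  choose t ht using fun i => b.value_surjective (x i)
  obtain rfl : (fun i => b.value (t i)) = x := funext ht
  simp only [relMap_value_iff] at H ⊢
  obtain ⟨i, hi⟩ := b.exists_eventually_conj h t
  filter_upwards [hi, H i] with l h₁ h₂ using h₁ h₂

theorem exists_similar_branch {n : ℕ} (R : (expandedLanguage F).Relations n) :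
    ∃ m, ∀ l ≥ m, ∀ η τ : Fin n → ℕ → Bool, SimilarMod l η τ →
      (Structure.RelMap R (fun i => b.value (Term.var (η i))) ↔
        Structure.RelMap R fun i => b.value (Term.var (τ i))) := by
  obtain ⟨m, hm⟩ := b.exists_similar (R.formula fun i => Term.var i)
    (BoundedFormula.IsAtomic.rel _ _).isQF
  refine ⟨m, fun l hl η τ h => ?_⟩
  simp only [relMap_value_iff, Term.realize_var]
  refine eventually_congr (eventually_atTop.2 ⟨l, fun l' hl' => ?_⟩)
  simpa only [Formula.realize_rel, Term.realize_var] using hm l hl η τ h l' hl' l' hl'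

end DecidingTree

end HanfContinuum

namespace HanfContinuum

open FirstOrder FirstOrder.Language Set Filter

/-! ### Borel presentation and cardinality -/

theorem measurable_cut (l : ℕ) : Measurable (cut l) :=
  measurable_pi_lambda _ fun m => measurable_pi_apply (m : ℕ)

namespace DecidingTree

variable {L : FirstOrder.Language.{0, 0}} {F : Set (Σ n, InfFormula L n)} {hF : IsFragment F}
  {A : Type} [(expandedLanguage F).Structure A] (b : DecidingTree hF A)

/-- Codes for the elements of the hull: a term and a sequence of branches. -/
abbrev Code (F : Set (Σ n, InfFormula L n)) : Type :=
  (expandedLanguage F).Term ℕ × (ℕ → ℕ → Bool)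

/-- The element with a given code. -/
noncomputable def decode (z : Code F) : b.hull := b.value (z.1.relabel z.2)

/-- A term uses only finitely many branches; the other entries of the sequence are filled with a
default. -/
theorem decode_surjective : Function.Surjective b.decode := by
  intro x
  obtain ⟨t, rfl⟩ := b.value_surjective x
  obtain ⟨k, η, s, -, hs⟩ := exists_eq_relabel fun _ : Unit => t
  refine ⟨((s ()).relabel Fin.val, fun m => if h : m < k then η ⟨m, h⟩ else default), ?_⟩
  rw [decode, hs (), Term.relabel_relabel]
  congr 2
  funext j
  simp

/-- Eventual truth is a countable union of countable intersections of conditions at fixed levels.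
Each of these is measurable because a cut depends on finitely many bits, while terms and elements of
`A` range over countable discrete spaces. -/
theorem measurableSet_realize_decode [Countable A] [Countable (Σ l, (expandedLanguage F).Functions l)]
    [MeasurableSpace ((expandedLanguage F).Term ℕ)]
    [DiscreteMeasurableSpace ((expandedLanguage F).Term ℕ)] {k : ℕ}
    (θ : (expandedLanguage F).Formula (Fin k)) (hθ : BoundedFormula.IsQF θ) :
    MeasurableSet {z : Fin k → Code F | θ.Realize fun i => b.decode (z i)} := by
  let _ : MeasurableSpace A := ⊤
  have h₁ : ∀ l, Measurable (b.approx l) := fun l =>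
    (measurable_of_countable (b.node l)).comp (measurable_cut l)
  have h₂ : ∀ (l : ℕ) (t : (expandedLanguage F).Term ℕ),
      Measurable fun η : ℕ → ℕ → Bool => t.realize fun m => b.approx l (η m) := by
    intro l t
    induction t with
    | var m => exact (h₁ l).comp (measurable_pi_apply m)
    | func f ts ih =>
      exact (measurable_of_countable (fun x : Fin _ → A => Structure.funMap f x)).comp
        (measurable_pi_lambda _ ih)
  have h₃ : ∀ l, Measurable fun z : Code F => z.1.realize fun m => b.approx l (z.2 m) := fun l =>
    measurable_from_prod_countable_right fun t => h₂ l t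
  have h₄ : ∀ l, MeasurableSet {z : Fin k → Code F |
      θ.Realize fun i => (z i).1.realize fun m => b.approx l ((z i).2 m)} := fun l =>
    (measurable_pi_lambda (fun (z : Fin k → Code F) i => (z i).1.realize fun m => b.approx l ((z i).2 m))
      fun i => (h₃ l).comp (measurable_pi_apply i)) (MeasurableSet.of_discrete (s := {x | θ.Realize x}))
  have : {z : Fin k → Code F | θ.Realize fun i => b.decode (z i)} =
      ⋃ n, ⋂ l ≥ n, {z : Fin k → Code F |
        θ.Realize fun i => (z i).1.realize fun m => b.approx l ((z i).2 m)} := by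
    ext z
    simp only [decode, mem_ofPred_eq, b.realize_value_iff θ hθ, eventually_atTop, mem_iUnion,
      mem_iInter, Term.realize_relabel]
    rfl
  rw [this]
  exact MeasurableSet.iUnion fun n => MeasurableSet.biInter (to_countable _) fun l _ => h₄ l

theorem isBorelStructure_hull [L.Structure b.hull]
    [(LHom.sumInl (L := L) (L' := fragmentLanguage F)).IsExpansionOn b.hull]
    [Countable A] [Countable (Σ l, (expandedLanguage F).Functions l)] :
    IsBorelStructure L b.hull := by
  let _ : MeasurableSpace ((expandedLanguage F).Term ℕ) := ⊤
  have : DiscreteMeasurableSpace ((expandedLanguage F).Term ℕ) := ⟨fun _ => trivial⟩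
  refine ⟨Code F, inferInstance, inferInstance, univ, fun z => b.decode z, MeasurableSet.univ,
    fun x => ?_, ?_, fun k φ hφ => ?_⟩
  · obtain ⟨z, rfl⟩ := b.decode_surjective x
    exact ⟨⟨z, trivial⟩, rfl⟩
  -- The equivalence relation is the case of the atomic formula that equates two variables.
  · have h := b.measurableSet_realize_decode
      ((Term.var 0).equal (Term.var 1) : (expandedLanguage F).Formula (Fin 2))
      (BoundedFormula.IsAtomic.equal _ _).isQF
    have hm : Measurable fun p : Code F × Code F => (![p.1, p.2] : Fin 2 → Code F) :=
      measurable_pi_lambda _ fun i => by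
        fin_cases i
        · exact measurable_fst
        · exact measurable_snd
    convert hm h using 1
    ext p
    simp [Formula.realize_equal]
  · convert b.measurableSet_realize_decode
      ((LHom.sumInl (L' := fragmentLanguage F)).onFormula φ)
      (isAtomic_onBoundedFormula _ hφ).isQF using 1
    ext z
    simp only [mem_univ, implies_true, exists_true_left, mem_ofPred_eq, LHom.realize_onFormula]

theorem mk_hull [Countable (Σ l, (expandedLanguage F).Functions l)] :
    Cardinal.mk b.hull = Cardinal.continuum := by
  refine le_antisymm ((Cardinal.mk_le_of_surjective b.decode_surjective).trans ?_) ?_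
  · have h : #((expandedLanguage F).Term ℕ) ≤ 𝔠 :=
      Cardinal.mk_le_aleph0.trans Cardinal.aleph0_le_continuum
    rw [Cardinal.mk_prod, Cardinal.lift_id, Cardinal.lift_id]
    calc _ ≤ 𝔠 * 𝔠 := mul_le_mul' h (by simp)
      _ = 𝔠 := Cardinal.continuum_mul_self
  · have : Function.Injective fun η : ℕ → Bool => b.value (Term.var η) := fun η τ h =>
      b.branch_injective (congrArg Subtype.val h)
    simpa using Cardinal.mk_le_of_injective this

end DecidingTree

theorem exists_decidingTree {L : FirstOrder.Language.{0, 0}} [Countable L.Symbols]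
    {F : Set (Σ n, InfFormula L n)} (hF : IsFragment F) (hFc : F.Countable) {M : Type u}
    [(expandedLanguage F).Structure M] (hC : ObeysConj F M)
    (hM : ((ω₁ : Ordinal.{u}) : WithTop Ordinal.{u}) ≤ structureSplittingRank (expandedLanguage F) M) :
    ∃ (A : Type) (_ : (expandedLanguage F).Structure A) (_ : A ↪[expandedLanguage F] M),
      Countable A ∧ Nonempty (DecidingTree hF A) := by
  have := countable_expandedLanguage F hFc
  have : Countable (Σ l, (expandedLanguage F).Functions l) :=
    Function.Injective.countable (β := (expandedLanguage F).Symbols) Sum.inl_injective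
  have := Task.countable hFc
  have : Nonempty (Task F) := ⟨.inl ⟨0, ⊥, BoundedFormula.isQF_bot⟩⟩
  obtain ⟨A, _, hA, g, b, hb, hdec⟩ := exists_countable_tree Task.arity (Task.cover hF)
    (Task.isQF_cover hF) (Task.exists_cover (A := M) hF hC) fun α hα => by
      obtain ⟨B, -, hB⟩ := exists_splittingRankGE hM hα
      exact ⟨B, hB⟩
  exact ⟨A, _, g, hA, ⟨⟨b, hb, hdec⟩⟩⟩

/-- `ForcesSplitting` concerns structures of size exactly `κ`. Closure under functions suffices,
because the Skolem functions are already in the language to which this is applied. -/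
theorem exists_substructure_card {L : FirstOrder.Language.{0, 0}} [Countable L.Symbols]
    {M : Type u} [L.Structure M] {κ : Cardinal.{u}} (hκ : ℵ₀ ≤ κ) (hM : κ ≤ #M) :
    ∃ S : L.Substructure M, #S = κ := by
  have : Countable (Σ l, L.Functions l) :=
    Function.Injective.countable (β := L.Symbols) Sum.inl_injective
  obtain ⟨s, hs⟩ := Cardinal.le_mk_iff_exists_set.1 hM
  refine ⟨Substructure.closure L s, le_antisymm ?_ ?_⟩
  · have := Substructure.lift_card_closure_le (L := L) (s := s)
    rw [hs] at this
    simp only [Cardinal.lift_uzero] at this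
    refine this.trans (max_le hκ (Cardinal.add_le_of_le hκ le_rfl (le_trans ?_ hκ)))
    rw [Cardinal.lift_le_aleph0]
    exact Cardinal.mk_le_aleph0
  · rw [← hs]
    exact Cardinal.mk_le_mk_of_subset Substructure.subset_closure

end HanfContinuum

/-! ### The theorem -/

open HanfContinuum FirstOrder FirstOrder.Language in
theorem theorem7p2p3 (L : FirstOrder.Language.{0, 0}) (hL : Countable L.Symbols)
    (Φ : HanfContinuum.InfSentence L)
    (M : Type u) [L.Structure M] (hΦ : Φ.Models M)
    (hM : HanfContinuum.lambdaOmegaOne.{u} ≤ ((Cardinal.mk M : Cardinal.{u}) : WithTop Cardinal.{u})) :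
    ∃ (N : Type) (_ : L.Structure N),
      Φ.Models N ∧ HanfContinuum.IsBorelStructure L N ∧ Cardinal.mk N = Cardinal.continuum ∧
        ∃ c : (ℕ → Bool) → N, HanfContinuum.AsymptoticallySimilar L c := by
  obtain ⟨κ, hκM, hκ⟩ := exists_forcesSplitting_of_le hM
  obtain ⟨F, hFc, hF, hΦF, hθF⟩ := exists_fragment Φ
  -- This makes `M` non-empty, as the choice of Skolem functions requires.
  have : Infinite M := Cardinal.infinite_iff.2 (hκ.aleph0_le.trans hκM)
  have hsymb := countable_expandedLanguage F hFc
  have : Countable (Σ l, (expandedLanguage F).Functions l) :=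
    Function.Injective.countable (β := (expandedLanguage F).Symbols) Sum.inl_injective
  let _ := fragmentStructure F M
  obtain ⟨S, hS⟩ := exists_substructure_card (L := expandedLanguage F) hκ.aleph0_le hκM
  have hU : ObeysUniversal F S := (obeysUniversal_fragmentStructure F M).of_embedding S.subtype
  have hC : ObeysConj F S := ObeysConj.of_embedding S.subtype (obeysConj_fragmentStructure F M)
  obtain ⟨A, _, g, hA, ⟨b⟩⟩ := exists_decidingTree hF hFc hC (hκ _ hsymb S hS)
  let _ : L.Structure b.hull := (LHom.sumInl (L' := fragmentLanguage F)).reduct b.hull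
  have hN {n : ℕ} {φ : InfFormula L n} (h : ⟨n, φ⟩ ∈ F) (x : Fin n → b.hull) :
      Structure.RelMap (formulaSymbol h) x ↔ φ.Realize x :=
    (b.obeysUniversal_hull (hU.of_embedding g)).relMap_iff hF b.obeysConj_hull h x
  refine ⟨b.hull, inferInstance, ?_, b.isBorelStructure_hull, b.mk_hull,
    fun η => b.value (Term.var η), ?_, ?_⟩
  · have hx : (Fin.elim0 : Fin 0 → b.hull) = fun i => b.value (Fin.elim0 i) :=
      Subsingleton.elim _ _
    refine (hN hΦF _).1 ?_
    -- `Φ` is a relation symbol without arguments. It holds in `M`, hence in `A`, where its truth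
    -- does not depend on the level.
    rw [hx, b.relMap_value_iff]
    refine .of_forall fun l => ?_
    rw [← g.map_rel, ← S.subtype.map_rel, relMap_fragmentStructure]
    refine (iff_of_eq (congrArg Φ.Realize (Subsingleton.elim _ _))).1 hΦ
  · exact fun η τ h => b.branch_injective (congrArg Subtype.val h)
  · intro k θ
    obtain ⟨n, hn⟩ := b.exists_similar_branch (formulaSymbol (hθF k θ))
    have key (x : Fin k → b.hull) : (toInf θ).Realize x ↔ θ.Realize x := by
      have := realize_toInf θ x default
      rwa [show Fin.append x default = x from Fin.append_right_nil _ _ rfl] at this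
    refine ⟨n, fun l hl η τ h => ?_⟩
    rw [← key, ← key, ← hN (hθF k θ), ← hN (hθF k θ)]
    exact hn l hl η τ h
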